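/- An instance of the non-overfitting group identification problem consists of objects $o_1,\dots,o_n$ with probabilities $p(o_i)>0$, $\sum_i p(o_i)=1$, $p_{\min}=\min_i p(o_i)$; a class $c(o_i)$ for every object, from a finite set of classes; finitely many tests $t$ forming a set $\mathcal T$, each with a positive integer cost $\mathrm{cost}(t)$ and an outcome $t(o_i)\in\{1,\dots,\nu_t\}$ for every object; and a threshold $\theta\in[0,1]$. For a set $N$ of objects put $p(N)=\sum_{o\in N}p(o)$, let $p_c(N)$ be the probability of the objects of class $c$ in $N$, let $h(N)$ be the number of unordered pairs of objects of $N$ with distinct classes, and let $N_t^v=\{o\in N: t(o)=v\}$; let $\mathcal O$ be the set of all objects. A decision tree has a test $t$ at each internal node, with one child for every outcome of $t$; it is feasible if every leaf, with set $N$ of objects reaching it, has $h(N)=0$ or $p(N)\le\theta$. Its expected cost is $\sum_i p(o_i)\cdot$(total cost of the tests that $o_i$ goes through). Assume that the instance has a feasible tree (in particular this holds if any two distinct objects are distinguished by some test). Impurity: $\Phi(N)=\sum_c\frac{p_c(N)}{p(N)}\Phi_c(N)$, where $\Phi_c(N)=-\log\frac{p_c(N)}{p(N)}$ (entropy) or $\Phi_c(N)=1-\frac{p_c(N)}{p(N)}$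 (Gini index); $\Phi(N\mid t)=\sum_v\frac{p(N_t^v)}{p(N)}\Phi(N_t^v)$; and $\Phi_{\max}=\max_{N\subseteq\mathcal O}\max_{o\in N}\Phi_{c(o)}(N)$. Coverage: for an object $o_i$ and a set $S$ of tests let $N^{(i)}_S$ be the set of objects that agree with $o_i$ on all tests in $S$, and put $$f_i(S)=1-\Bigl(1-\min\Bigl\{\tfrac{1-p(N^{(i)}_S)}{1-\max\{p(o_i),\theta\}},1\Bigr\}\Bigr)\Bigl(1-\tfrac{h(\mathcal O)-h(N^{(i)}_S)}{h(\mathcal O)}\Bigr).$$ Greedy algorithm with parameter $\lambda\ge0$: it starts at the node $N=\mathcal O$ with $S=\emptyset$. At a node $N$ with used tests $S$, if all objects of $N$ have the same class or $p(N)\le\theta$, it returns a leaf labelled with a majority class (one that maximizes $p_c(N)$). Otherwise it picks a test $t\in\mathcal T\setminus S$ maximizing $$\frac1{\mathrm{cost}(t)}\Bigl(p(N)-p(N_t^{v^*})+\sum_{i:\,o_i\in N}p(o_i)\frac{f_i(S\cup\{t\})-f_i(S)}{f_i(\mathcal T)-f_i(S)}+\lambda\,p(N)\bigl(\Phi(N)-\Phi(N\mid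 t)\bigr)\Bigr),\qquad v^*\in\arg\max_v|N_t^v|,$$ and recurses on every child $N_t^v$ with used tests $S\cup\{t\}$. Ties are broken arbitrarily. Corollary. For the entropy and for the Gini index, the greedy algorithm is an $O(\log\frac1{p_{\min}}+\log n)$-approximation: there is an absolute constant $C>0$ such that, for every instance as above and every $\lambda\ge0$, the algorithm returns a tree, and every tree that it can return is feasible and has expected cost at most $$C\,(1+\lambda)\Bigl(\log\frac1{p_{\min}}+\log n\Bigr)$$ times the expected cost of any feasible tree, in particular of an optimal one. Moreover $\Phi_{\max}\le\log\frac1{p_{\min}}$ for the entropy and $\Phi_{\max}\le1$ for the Gini index. -/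

import Mathlib

open scoped BigOperators

namespace GroupId

/-- Decision trees over `m` tests, where test `t` has `arity t` possible outcomes, and with leaves
labelled by one of `k` classes. -/
inductive DecisionTree (k : ℕ) {m : ℕ} (arity : Fin m → ℕ) : Type where
  | leaf (label : Fin k) : DecisionTree k arity
  | node (t : Fin m) (child : Fin (arity t) → DecisionTree k arity) : DecisionTree k arity

/-- An instance of non-overfitting group identification with `n` objects, `k` classes and
`m` tests. -/
structure Problem (n k m : ℕ) where
  /-- probability of each object -/
  prob : Fin n → ℝ
  prob_pos : ∀ i, 0 < prob i
  prob_sum : ∑ i, prob i = 1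
  /-- class of each object -/
  cls : Fin n → Fin k
  /-- number of possible outcomes of each test -/
  arity : Fin m → ℕ
  /-- outcome of a test on an object -/
  outcome : (t : Fin m) → Fin n → Fin (arity t)
  /-- integral cost of each test -/
  cost : Fin m → ℕ
  cost_pos : ∀ t, 0 < cost t
  /-- stopping threshold -/
  thr : ℝ
  thr_nonneg : 0 ≤ thr
  thr_le_one : thr ≤ 1

/-- The score assigned to a class of proportion `x`; the resulting impurity is the entropy. -/
noncomputable def entropyScore (x : ℝ) : ℝ := -Real.log x

/-- The score assigned to a class of proportion `x`; the resulting impurity is the Gini index. -/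
def giniScore (x : ℝ) : ℝ := 1 - x

namespace Problem

variable {n k m : ℕ} (I : Problem n k m)

/-- The smallest probability of an object. -/
noncomputable def minProb : ℝ := ⨅ i, I.prob i

/-- Total probability of a set of objects. -/
def mass (N : Finset (Fin n)) : ℝ := ∑ i ∈ N, I.prob i

/-- Total probability of the objects of class `c` in `N`. -/
def classMass (c : Fin k) (N : Finset (Fin n)) : ℝ := ∑ i ∈ N with I.cls i = c, I.prob i

/-- All objects of `N` have the same class. -/
def Homogeneous (N : Finset (Fin n)) : Prop := ∀ i ∈ N, ∀ j ∈ N, I.cls i = I.cls j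

/-- Number of unordered pairs of objects of `N` that have distinct classes. -/
def hetPairs (N : Finset (Fin n)) : ℕ :=
  ((N ×ˢ N).filter fun q => q.1 < q.2 ∧ I.cls q.1 ≠ I.cls q.2).card

/-- The child of the node `N` under test `t` along the branch with outcome `v`. -/
def childNode (N : Finset (Fin n)) (t : Fin m) (v : Fin (I.arity t)) : Finset (Fin n) :=
  N.filter fun i => I.outcome t i = v

/-- The objects that agree with object `i` on all tests in `S`. -/
def agreeing (i : Fin n) (S : Finset (Fin m)) : Finset (Fin n) :=
  Finset.univ.filter fun j => ∀ t ∈ S, I.outcome t j = I.outcome t i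

/-! Trees as solutions -/

/-- Every leaf of the tree, when the tree is applied to the objects of `N`, receives a set of
objects with no heterogeneous pair or with probability at most the threshold. -/
def FeasibleOn : DecisionTree k I.arity → Finset (Fin n) → Prop
  | .leaf _, N => I.hetPairs N = 0 ∨ I.mass N ≤ I.thr
  | .node t child, N => ∀ v, FeasibleOn (child v) (I.childNode N t v)

/-- Feasible solutions. -/
def Feasible (T : DecisionTree k I.arity) : Prop := I.FeasibleOn T Finset.univ

/-- Total cost of the tests that object `i` goes through. -/
def pathCost : DecisionTree k I.arity → Fin n → ℕ
  | .leaf _, _ => 0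
  | .node t child, i => I.cost t + pathCost (child (I.outcome t i)) i

/-- Expected cost of a tree. -/
def expectedCost (T : DecisionTree k I.arity) : ℝ := ∑ i, I.prob i * (I.pathCost T i : ℝ)

/-! Decomposable impurity, for a class score `φ` that is a function of the class proportion -/

/-- Score of class `c` in node `N`. -/
noncomputable def classScore (φ : ℝ → ℝ) (c : Fin k) (N : Finset (Fin n)) : ℝ :=
  φ (I.classMass c N / I.mass N)

/-- Impurity of a node. -/
noncomputable def impurity (φ : ℝ → ℝ) (N : Finset (Fin n)) : ℝ :=
  ∑ c, I.classMass c N / I.mass N * I.classScore φ c N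

/-- Impurity of a node after splitting it by test `t`. -/
noncomputable def impurityAfter (φ : ℝ → ℝ) (N : Finset (Fin n)) (t : Fin m) : ℝ :=
  ∑ v, I.mass (I.childNode N t v) / I.mass N * I.impurity φ (I.childNode N t v)

/-- The maximum, over sets of objects `N` and objects `i ∈ N`, of the score in `N` of the class
of `i`. -/
noncomputable def maxScore (φ : ℝ → ℝ) : ℝ :=
  ⨆ x : {x : Finset (Fin n) × Fin n // x.2 ∈ x.1}, I.classScore φ (I.cls x.1.2) x.1.1

/-! The submodular functions attached to the objects -/

/-- Truncated scaled probability of the objects separated from `i`. -/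
noncomputable def probCover (i : Fin n) (S : Finset (Fin m)) : ℝ :=
  min ((1 - I.mass (I.agreeing i S)) / (1 - max (I.prob i) I.thr)) 1

/-- Fraction of the heterogeneous pairs that are no longer together with `i`. -/
noncomputable def pairCover (i : Fin n) (S : Finset (Fin m)) : ℝ :=
  ((I.hetPairs Finset.univ : ℝ) - I.hetPairs (I.agreeing i S)) / I.hetPairs Finset.univ

/-- The disjunction of the two functions above. -/
noncomputable def orCover (i : Fin n) (S : Finset (Fin m)) : ℝ :=
  1 - (1 - I.probCover i S) * (1 - I.pairCover i S)

/-! The greedy algorithm -/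

/-- Greedy score of test `t` at node `N` after the tests `S`, when `v` is the branch of `t` that is
taken as the largest one. -/
noncomputable def score (φ : ℝ → ℝ) (lam : ℝ) (N : Finset (Fin n)) (S : Finset (Fin m))
    (t : Fin m) (v : Fin (I.arity t)) : ℝ :=
  1 / (I.cost t : ℝ) *
      (I.mass N - I.mass (I.childNode N t v) +
        ∑ i ∈ N, I.prob i *
          ((I.orCover i (insert t S) - I.orCover i S) /
            (I.orCover i Finset.univ - I.orCover i S))) +
    1 / (I.cost t : ℝ) * lam * I.mass N * (I.impurity φ N - I.impurityAfter φ N t)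

/-- `t` is an unused test of largest score, for some choice of a child of largest cardinality for
every test (ties may be broken in any way). -/
def IsGreedyTest (φ : ℝ → ℝ) (lam : ℝ) (N : Finset (Fin n)) (S : Finset (Fin m))
    (t : Fin m) : Prop :=
  ∃ big : (s : Fin m) → Fin (I.arity s),
    (∀ s v, (I.childNode N s v).card ≤ (I.childNode N s (big s)).card) ∧
    t ∉ S ∧ ∀ s, s ∉ S → I.score φ lam N S s (big s) ≤ I.score φ lam N S t (big t)

/-- The stopping rule. -/
def Stops (N : Finset (Fin n)) : Prop := I.Homogeneous N ∨ I.mass N ≤ I.thr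

/-- `GreedyRun φ lam N S T`: the recursive greedy procedure, called on the node `N` with the set
`S` of tests used so far, can return the tree `T` (for some way of breaking ties). -/
inductive GreedyRun (φ : ℝ → ℝ) (lam : ℝ) :
    Finset (Fin n) → Finset (Fin m) → DecisionTree k I.arity → Prop where
  | leaf (N : Finset (Fin n)) (S : Finset (Fin m)) (c : Fin k) (hdone : I.Stops N)
      (hmaj : ∀ c', I.classMass c' N ≤ I.classMass c N) :
      GreedyRun φ lam N S (.leaf c)
  | node (N : Finset (Fin n)) (S : Finset (Fin m)) (t : Fin m)
      (child : Fin (I.arity t) → DecisionTree k I.arity) (hgo : ¬ I.Stops N)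
      (ht : I.IsGreedyTest φ lam N S t)
      (hchild : ∀ v, GreedyRun φ lam (I.childNode N t v) (insert t S) (child v)) :
      GreedyRun φ lam N S (.node t child)

/-- `T` is a possible output of the greedy algorithm on the whole instance. -/
def IsGreedyOutput (φ : ℝ → ℝ) (lam : ℝ) (T : DecisionTree k I.arity) : Prop :=
  I.GreedyRun φ lam Finset.univ ∅ T

end Problem

end GroupId

namespace GroupId

namespace Problem

variable {n k m : ℕ} (I : Problem n k m)

/-! Masses, heterogeneous pairs and nodes -/

/-! The proof charges the greedy cost to a potential that telescopes down the tree, and bounds the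
greedy rate of progress from below by any feasible tree.

Since a feasible tree exists, all tests together cover every object (`Feasible.solvable`). At a
non-stopping node `N` reached by `S`, the quantity `1 - f_i(S)` is then `residual i N`, so cost
times score is `coverGain` plus the impurity term (`cost_mul_score`).

Upper bound on progress: `potential` sums, over the objects of a node, their probability times
`log₂` of the node's size plus `demand`, and adds `lam` times mass times impurity. Leaving the
largest branch at least halves the size, relative drops of the residual add up to a logarithm, and
mass-weighted impurity telescopes. Hence the gain of a test plus the children's potentials is at
most the node's potential (`gain_add_potential_le`), which is at most mass times `G =
O((1+lam)(log(1/p_min) + log n))`.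

Lower bound on progress: follow the largest branches at `N` through a feasible tree `T'`. An object
of `N` finished by `T'` within cost `τ` either leaves this path, and is counted in the mass outside
some largest branch, or ends at its leaf fully covered. Supermodularity of the residual bounds what
each test on the path contributes by its gain at `N`, hence by its cost times the greedy score. So
the mass finished within `τ` is at most `τ` times that score (`mass_done_le_mul_score`).

Combination (`GreedyRun.cost_bound`): with `d` already spent and a next test of cost `c`, objects
whose scaled cost `L * pathCost T'` exceeds `d + c` pay from the excess over `d`; the others have
mass at most `(d + c) / L` times the score and are paid by the drop of potential. Taking `L = 2G` at
the root gives the ratio `4G`. -/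

lemma mass_nonneg (N : Finset (Fin n)) : 0 ≤ I.mass N :=
  Finset.sum_nonneg fun i _ => (I.prob_pos i).le

lemma mass_mono {A B : Finset (Fin n)} (h : A ⊆ B) : I.mass A ≤ I.mass B :=
  Finset.sum_le_sum_of_subset_of_nonneg h fun i _ _ => (I.prob_pos i).le

lemma mass_univ : I.mass Finset.univ = 1 := I.prob_sum

lemma mass_le_one (N : Finset (Fin n)) : I.mass N ≤ 1 :=
  I.mass_univ ▸ I.mass_mono (Finset.subset_univ N)

lemma mass_pos {N : Finset (Fin n)} (h : N.Nonempty) : 0 < I.mass N :=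
  Finset.sum_pos (fun i _ => I.prob_pos i) h

lemma mass_sdiff {A B : Finset (Fin n)} (h : A ⊆ B) : I.mass (B \ A) = I.mass B - I.mass A := by
  have := Finset.sum_sdiff (f := I.prob) h
  unfold mass
  linarith

lemma nonempty_index (I : Problem n k m) : Nonempty (Fin n) := by
  rcases isEmpty_or_nonempty (Fin n) with h | h
  · have := I.prob_sum
    simp at this
  · exact h

lemma minProb_le (i : Fin n) : I.minProb ≤ I.prob i :=
  ciInf_le (Set.finite_range I.prob).bddBelow i

lemma minProb_pos : 0 < I.minProb := by
  have := I.nonempty_index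
  obtain ⟨i, hi⟩ := exists_eq_ciInf_of_finite (f := I.prob)
  unfold minProb
  rw [← hi]
  exact I.prob_pos i

lemma minProb_le_one : I.minProb ≤ 1 := by
  obtain ⟨i⟩ := I.nonempty_index
  have h : I.prob i ≤ I.mass Finset.univ :=
    Finset.single_le_sum (f := I.prob) (fun j _ => (I.prob_pos j).le) (Finset.mem_univ i)
  exact (I.minProb_le i).trans (h.trans (I.mass_le_one _))

lemma card_mul_minProb_le_one : (n : ℝ) * I.minProb ≤ 1 := by
  have h := Finset.card_nsmul_le_sum Finset.univ I.prob I.minProb fun i _ => I.minProb_le i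
  rw [I.prob_sum] at h
  simpa using h

lemma mass_add_minProb_le {A B : Finset (Fin n)} (h : A ⊂ B) :
    I.mass A + I.minProb ≤ I.mass B := by
  obtain ⟨i, hi, hiA⟩ := Finset.exists_of_ssubset h
  have h1 : I.mass (insert i A) ≤ I.mass B := I.mass_mono (Finset.insert_subset hi h.subset)
  have h2 : I.mass (insert i A) = I.prob i + I.mass A := Finset.sum_insert hiA
  have h3 := I.minProb_le i
  linarith

lemma sum_childNode (g : Fin n → ℝ) (N : Finset (Fin n)) (t : Fin m) :
    ∑ v, ∑ i ∈ I.childNode N t v, g i = ∑ i ∈ N, g i :=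
  Finset.sum_fiberwise N (I.outcome t) g

lemma childNode_subset (N : Finset (Fin n)) (t : Fin m) (v : Fin (I.arity t)) :
    I.childNode N t v ⊆ N :=
  Finset.filter_subset _ _

@[simp] lemma mem_childNode {N : Finset (Fin n)} {t : Fin m} {v : Fin (I.arity t)} {i : Fin n} :
    i ∈ I.childNode N t v ↔ i ∈ N ∧ I.outcome t i = v := by
  simp [childNode]

@[simp] lemma mem_agreeing {S : Finset (Fin m)} {i j : Fin n} :
    j ∈ I.agreeing i S ↔ ∀ t ∈ S, I.outcome t j = I.outcome t i := by
  simp [agreeing]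

lemma agreeing_insert (i : Fin n) (S : Finset (Fin m)) (t : Fin m) :
    I.agreeing i (insert t S) = I.childNode (I.agreeing i S) t (I.outcome t i) := by
  ext j
  simp [and_comm]

/-- The heterogeneous pairs of a set of objects. -/
def hetPairSet (N : Finset (Fin n)) : Finset (Fin n × Fin n) :=
  (N ×ˢ N).filter fun q => q.1 < q.2 ∧ I.cls q.1 ≠ I.cls q.2

lemma hetPairs_mono {A B : Finset (Fin n)} (h : A ⊆ B) : I.hetPairs A ≤ I.hetPairs B :=
  Finset.card_le_card (Finset.filter_subset_filter _ (Finset.product_subset_product h h))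

lemma hetPairs_eq_zero_iff {N : Finset (Fin n)} : I.hetPairs N = 0 ↔ I.Homogeneous N := by
  unfold hetPairs Homogeneous
  rw [Finset.card_eq_zero, Finset.filter_eq_empty_iff]
  constructor
  · intro h i hi j hj
    by_contra hne
    rcases lt_trichotomy i j with hlt | heq | hlt
    · exact h (x := (i, j)) (by simp [hi, hj]) ⟨hlt, hne⟩
    · exact hne (congrArg _ heq)
    · exact h (x := (j, i)) (by simp [hi, hj]) ⟨hlt, Ne.symm hne⟩
  · rintro h ⟨i, j⟩ hq ⟨-, hne⟩
    rw [Finset.mem_product] at hq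
    exact hne (h i hq.1 j hq.2)

lemma hetPairs_le_sq (N : Finset (Fin n)) : I.hetPairs N ≤ n ^ 2 := by
  refine (Finset.card_filter_le _ _).trans ?_
  rw [Finset.card_product, ← sq]
  exact Nat.pow_le_pow_left (by simpa using Finset.card_le_univ N) 2

/-- Restricting both sets loses at least as many heterogeneous pairs in the larger one. -/
lemma hetPairs_supermodular (A B C : Finset (Fin n)) (h : B ⊆ A) :
    I.hetPairs B + I.hetPairs (A ∩ C) ≤ I.hetPairs A + I.hetPairs (B ∩ C) := by
  have key : I.hetPairSet B ∪ I.hetPairSet (A ∩ C) ⊆ I.hetPairSet A := by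
    refine Finset.union_subset ?_ ?_
    · exact Finset.filter_subset_filter _ (Finset.product_subset_product h h)
    · exact Finset.filter_subset_filter _
        (Finset.product_subset_product Finset.inter_subset_left Finset.inter_subset_left)
  have key2 : I.hetPairSet B ∩ I.hetPairSet (A ∩ C) ⊆ I.hetPairSet (B ∩ C) := by
    rintro ⟨i, j⟩
    simp only [hetPairSet, Finset.mem_inter, Finset.mem_filter, Finset.mem_product]
    tauto
  have h1 := Finset.card_le_card key
  have h2 := Finset.card_le_card key2
  have h3 := Finset.card_union_add_card_inter (I.hetPairSet B) (I.hetPairSet (A ∩ C))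
  change (I.hetPairSet B).card + (I.hetPairSet (A ∩ C)).card ≤
    (I.hetPairSet A).card + (I.hetPairSet (B ∩ C)).card
  omega

lemma mass_supermodular (A B C : Finset (Fin n)) (h : B ⊆ A) :
    I.mass B - I.mass (B ∩ C) ≤ I.mass A - I.mass (A ∩ C) := by
  rw [← I.mass_sdiff Finset.inter_subset_left, ← I.mass_sdiff Finset.inter_subset_left]
  refine I.mass_mono ?_
  intro i
  simp only [Finset.mem_sdiff, Finset.mem_inter]
  have := @h i
  tauto

lemma stops_iff {N : Finset (Fin n)} : I.Stops N ↔ I.hetPairs N = 0 ∨ I.mass N ≤ I.thr := by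
  rw [Stops, hetPairs_eq_zero_iff]

lemma Stops.mono {A B : Finset (Fin n)} (hB : I.Stops B) (h : A ⊆ B) : I.Stops A := by
  rcases hB with hB | hB
  · exact .inl fun i hi j hj => hB i (h hi) j (h hj)
  · exact .inr ((I.mass_mono h).trans hB)

/-- Objects that agree on all tests travel together in any tree, so they all end at one leaf, which
is feasible; stopping passes to subsets. -/
lemma stops_agreeing_univ_of_feasibleOn {T : DecisionTree k I.arity} {X : Finset (Fin n)}
    (hT : I.FeasibleOn T X) {i : Fin n} (hX : I.agreeing i Finset.univ ⊆ X) :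
    I.Stops (I.agreeing i Finset.univ) := by
  induction T generalizing X with
  | leaf c => exact Stops.mono I (I.stops_iff.2 hT) hX
  | node t child ih =>
    refine ih (I.outcome t i) (hT (I.outcome t i)) ?_
    intro j hj
    exact I.mem_childNode.2 ⟨hX hj, I.mem_agreeing.1 hj t (Finset.mem_univ t)⟩

/-! Nodes reached by a set of tests -/

/-- The objects of `N` are exactly those that agree with any one of them on the tests in `S`. -/
def Reached (N : Finset (Fin n)) (S : Finset (Fin m)) : Prop := ∀ i ∈ N, I.agreeing i S = N

lemma reached_univ : I.Reached Finset.univ ∅ := by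
  intro i _
  ext j
  simp

lemma Reached.child {N : Finset (Fin n)} {S : Finset (Fin m)} (h : I.Reached N S) (t : Fin m)
    (v : Fin (I.arity t)) : I.Reached (I.childNode N t v) (insert t S) := by
  intro i hi
  rw [mem_childNode] at hi
  rw [agreeing_insert, h i hi.1, hi.2]

/-! Residual demand -/

/-- The mass that an object can be left with. -/
noncomputable def cap (i : Fin n) : ℝ := max (I.prob i) I.thr

/-- The part of the demand of object `i` that is left at node `N`. -/
noncomputable def residual (i : Fin n) (N : Finset (Fin n)) : ℝ :=
  max ((I.mass N - I.cap i) / (1 - I.cap i)) 0 * ((I.hetPairs N : ℝ) / I.hetPairs Finset.univ)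

/-- The truncation at 1 in `probCover` becomes a truncation at 0 of the remaining demand, and the
disjunction becomes a product. From here on the functions of test sets are handled as functions of
nodes. -/
lemma orCover_eq {i : Fin n} (hi : I.cap i < 1) (hh : 0 < I.hetPairs Finset.univ)
    (S : Finset (Fin m)) : I.orCover i S = 1 - I.residual i (I.agreeing i S) := by
  have hh' : (0 : ℝ) < I.hetPairs Finset.univ := by exact_mod_cast hh
  have h1 : 1 - I.cap i ≠ 0 := by linarith
  have e1 : 1 - I.probCover i S = max ((I.mass (I.agreeing i S) - I.cap i) / (1 - I.cap i)) 0 := by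
    unfold probCover
    change 1 - min ((1 - I.mass (I.agreeing i S)) / (1 - I.cap i)) 1 = _
    have e : (I.mass (I.agreeing i S) - I.cap i) / (1 - I.cap i) =
        1 - (1 - I.mass (I.agreeing i S)) / (1 - I.cap i) := by
      field_simp
      ring
    rw [e]
    rcases le_total ((1 - I.mass (I.agreeing i S)) / (1 - I.cap i)) 1 with h | h
    · rw [min_eq_left h, max_eq_left (by linarith)]
    · rw [min_eq_right h, max_eq_right (by linarith)]
      ring
  have e2 : 1 - I.pairCover i S = (I.hetPairs (I.agreeing i S) : ℝ) / I.hetPairs Finset.univ := by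
    unfold pairCover
    field_simp
    ring
  unfold orCover residual
  rw [e1, e2]

lemma residual_nonneg (i : Fin n) (N : Finset (Fin n)) : 0 ≤ I.residual i N := by
  unfold residual
  positivity

lemma residual_le_one {i : Fin n} (hi : I.cap i < 1) (N : Finset (Fin n)) :
    I.residual i N ≤ 1 := by
  unfold residual
  have h1 : max ((I.mass N - I.cap i) / (1 - I.cap i)) 0 ≤ 1 := by
    refine max_le ?_ zero_le_one
    rw [div_le_one (by linarith)]
    linarith [I.mass_le_one N]
  have h2 : ((I.hetPairs N : ℝ) / I.hetPairs Finset.univ) ≤ 1 := by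
    refine div_le_one_of_le₀ ?_ (Nat.cast_nonneg _)
    exact_mod_cast I.hetPairs_mono (Finset.subset_univ N)
  exact mul_le_one₀ h1 (by positivity) h2

lemma residual_mono {i : Fin n} (hi : I.cap i < 1) {A B : Finset (Fin n)} (h : A ⊆ B) :
    I.residual i A ≤ I.residual i B := by
  unfold residual
  have h1 : (0 : ℝ) ≤ 1 - I.cap i := by linarith
  have h2 := I.mass_mono h
  have h3 : (I.hetPairs A : ℝ) ≤ I.hetPairs B := by exact_mod_cast I.hetPairs_mono h
  gcongr

/-- Both factors of the residual are nonnegative, monotone and have decrements that grow with the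
set; these properties together pass to products. -/
lemma residual_supermodular {i : Fin n} (hi : I.cap i < 1) {A B : Finset (Fin n)} (h : B ⊆ A)
    (C : Finset (Fin n)) :
    I.residual i B - I.residual i (B ∩ C) ≤ I.residual i A - I.residual i (A ∩ C) := by
  have hc : (0 : ℝ) < 1 - I.cap i := by linarith
  have hh : (I.hetPairs B : ℝ) + I.hetPairs (A ∩ C) ≤ I.hetPairs A + I.hetPairs (B ∩ C) := by
    exact_mod_cast I.hetPairs_supermodular A B C h
  have hm := I.mass_supermodular A B C h
  have m1 := I.mass_mono h
  have m2 : I.mass (B ∩ C) ≤ I.mass B := I.mass_mono Finset.inter_subset_left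
  have m3 : I.mass (B ∩ C) ≤ I.mass (A ∩ C) :=
    I.mass_mono (Finset.inter_subset_inter_right h)
  have h2 : (I.hetPairs (B ∩ C) : ℝ) ≤ I.hetPairs B := by
    exact_mod_cast I.hetPairs_mono Finset.inter_subset_left
  have h3 : (I.hetPairs (B ∩ C) : ℝ) ≤ I.hetPairs (A ∩ C) := by
    exact_mod_cast I.hetPairs_mono (Finset.inter_subset_inter_right h)
  unfold residual
  set D : ℝ := ((I.hetPairs Finset.univ : ℕ) : ℝ)
  have hD : 0 ≤ D := Nat.cast_nonneg _
  have u1 : max ((I.mass B - I.cap i) / (1 - I.cap i)) 0 ≤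
      max ((I.mass A - I.cap i) / (1 - I.cap i)) 0 := by gcongr
  have u2 : max ((I.mass (B ∩ C) - I.cap i) / (1 - I.cap i)) 0 ≤
      max ((I.mass B - I.cap i) / (1 - I.cap i)) 0 := by gcongr
  -- Truncation at 0 is convex and nondecreasing, so a shorter drop lying lower stays the shorter
  -- one.
  have u3 : max ((I.mass B - I.cap i) / (1 - I.cap i)) 0 -
      max ((I.mass (B ∩ C) - I.cap i) / (1 - I.cap i)) 0 ≤
      max ((I.mass A - I.cap i) / (1 - I.cap i)) 0 -
      max ((I.mass (A ∩ C) - I.cap i) / (1 - I.cap i)) 0 := by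
    have e1 : (I.mass B - I.cap i) / (1 - I.cap i) - (I.mass (B ∩ C) - I.cap i) / (1 - I.cap i) ≤
        (I.mass A - I.cap i) / (1 - I.cap i) - (I.mass (A ∩ C) - I.cap i) / (1 - I.cap i) := by
      rw [← sub_div, ← sub_div]
      gcongr ?_ / _
      linarith
    have e2 : (I.mass B - I.cap i) / (1 - I.cap i) ≤ (I.mass A - I.cap i) / (1 - I.cap i) := by
      gcongr
    have e3 : (I.mass (B ∩ C) - I.cap i) / (1 - I.cap i) ≤
        (I.mass (A ∩ C) - I.cap i) / (1 - I.cap i) := by gcongr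
    have e4 : (I.mass (A ∩ C) - I.cap i) / (1 - I.cap i) ≤
        (I.mass A - I.cap i) / (1 - I.cap i) := by
      gcongr
      exact I.mass_mono Finset.inter_subset_left
    rcases max_cases ((I.mass B - I.cap i) / (1 - I.cap i)) 0 with a | a <;>
    rcases max_cases ((I.mass A - I.cap i) / (1 - I.cap i)) 0 with b | b <;>
    rcases max_cases ((I.mass (B ∩ C) - I.cap i) / (1 - I.cap i)) 0 with c | c <;>
    rcases max_cases ((I.mass (A ∩ C) - I.cap i) / (1 - I.cap i)) 0 with d | d <;>
    linarith
  have w2 : (I.hetPairs (B ∩ C) : ℝ) / D ≤ I.hetPairs B / D := by gcongr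
  have w3 : (I.hetPairs (B ∩ C) : ℝ) / D ≤ I.hetPairs (A ∩ C) / D := by gcongr
  have w4 : (I.hetPairs B : ℝ) / D - I.hetPairs (B ∩ C) / D ≤
      I.hetPairs A / D - I.hetPairs (A ∩ C) / D := by
    rw [← sub_div, ← sub_div]
    gcongr ?_ / _
    linarith
  have z1 : (0 : ℝ) ≤ I.hetPairs (B ∩ C) / D := by positivity
  have z2 : 0 ≤ max ((I.mass B - I.cap i) / (1 - I.cap i)) 0 := le_max_right _ _
  -- Writing `u`, `w` for the two factors and a prime for their values after intersecting with `C`,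
  -- the decrement of the product splits as `u (w - w') + w' (u - u')`; the two summands are
  -- compared separately.
  have p1 := mul_le_mul u1 w4 (by linarith) (by linarith)
  have p2 := mul_le_mul w3 u3 (by linarith) (by linarith)
  linarith

lemma residual_eq_zero_of_stops {i : Fin n} (hi : I.cap i < 1) {N : Finset (Fin n)}
    (h : I.Stops N) : I.residual i N = 0 := by
  unfold residual
  rcases I.stops_iff.1 h with h | h
  · simp [h]
  · rw [max_eq_right, zero_mul]
    refine div_nonpos_of_nonpos_of_nonneg ?_ (by linarith)
    linarith [le_max_right (I.prob i) I.thr, show I.cap i = max (I.prob i) I.thr from rfl]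

/-- If `i` alone carried the mass of `N`, then `N` would be `{i}`, which is homogeneous. This
strictness keeps residuals positive and the denominators in the greedy score nonzero. -/
lemma cap_lt_mass {N : Finset (Fin n)} (h : ¬ I.Stops N) {i : Fin n} (hi : i ∈ N) :
    I.cap i < I.mass N := by
  simp only [Stops, not_or, not_le] at h
  refine max_lt ?_ h.2
  by_contra hle
  apply h.1
  have hss : N = {i} := by
    by_contra hne
    have hs : ({i} : Finset (Fin n)) ⊂ N :=
      lt_of_le_of_ne (by simpa using hi) (Ne.symm hne)
    have := I.mass_add_minProb_le hs
    have h2 := I.minProb_pos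
    simp only [mass, Finset.sum_singleton] at this hle
    linarith
  rw [hss]
  intro a ha b hb
  rw [Finset.mem_singleton.1 ha, Finset.mem_singleton.1 hb]

lemma cap_lt_one {N : Finset (Fin n)} (h : ¬ I.Stops N) {i : Fin n} (hi : i ∈ N) :
    I.cap i < 1 :=
  (I.cap_lt_mass h hi).trans_le (I.mass_le_one N)

lemma hetPairs_univ_pos {N : Finset (Fin n)} (h : ¬ I.Stops N) :
    0 < I.hetPairs Finset.univ := by
  rw [stops_iff, not_or] at h
  exact (Nat.pos_of_ne_zero h.1).trans_le (I.hetPairs_mono (Finset.subset_univ N))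

lemma residual_pos {N : Finset (Fin n)} (h : ¬ I.Stops N) {i : Fin n} (hi : i ∈ N) :
    0 < I.residual i N := by
  have h0 := I.hetPairs_univ_pos h
  have h1 := I.cap_lt_mass h hi
  have h2 := I.cap_lt_one h hi
  rw [stops_iff, not_or] at h
  have h3 := Nat.pos_of_ne_zero h.1
  unfold residual
  have h4 : 0 < (I.mass N - I.cap i) / (1 - I.cap i) := div_pos (by linarith) (by linarith)
  exact mul_pos (lt_max_of_lt_left h4) (by positivity)

end Problem

/-! ### Class scores: entropy and Gini index -/

/-- A class score whose impurity is concave and which is at most `B` on proportions `≥ p`. -/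
structure ScoreBound (φ : ℝ → ℝ) (p B : ℝ) : Prop where
  concave : ConcaveOn ℝ (Set.Ici 0) fun x => x * φ x
  nonneg : ∀ x, 0 ≤ x → x ≤ 1 → 0 ≤ φ x
  le : ∀ x, p ≤ x → x ≤ 1 → φ x ≤ B

lemma scoreBound_entropyScore {p : ℝ} (hp : 0 < p) :
    ScoreBound entropyScore p (Real.log (1 / p)) where
  concave := by
    refine Real.concaveOn_negMulLog.congr ?_
    intro x _
    simp [Real.negMulLog, entropyScore]
  nonneg x h0 h1 := by
    have := Real.log_nonpos h0 h1
    unfold entropyScore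
    linarith
  le x h0 _ := by
    have := Real.log_le_log hp h0
    rw [one_div, Real.log_inv]
    unfold entropyScore
    linarith

lemma scoreBound_giniScore {p : ℝ} (hp : 0 ≤ p) : ScoreBound giniScore p 1 where
  concave := by
    have h1 : ConcaveOn ℝ (Set.Ici (0 : ℝ)) fun x : ℝ => x := concaveOn_id (convex_Ici 0)
    have h := h1.sub (convexOn_pow (𝕜 := ℝ) 2)
    refine h.congr ?_
    intro x _
    simp only [Pi.sub_apply, giniScore]
    ring
  nonneg x _ h1 := by
    unfold giniScore
    linarith
  le x h0 _ := by
    unfold giniScore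
    linarith

lemma ScoreBound.mono {φ : ℝ → ℝ} {p B B' : ℝ} (h : ScoreBound φ p B) (hB : B ≤ B') :
    ScoreBound φ p B' :=
  ⟨h.concave, h.nonneg, fun x h0 h1 => (h.le x h0 h1).trans hB⟩

namespace Problem

variable {n k m : ℕ} (I : Problem n k m)

/-! Impurity -/

lemma classMass_nonneg (c : Fin k) (N : Finset (Fin n)) : 0 ≤ I.classMass c N :=
  I.mass_nonneg (N.filter fun i => I.cls i = c)

lemma classMass_le_mass (c : Fin k) (N : Finset (Fin n)) : I.classMass c N ≤ I.mass N :=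
  I.mass_mono (Finset.filter_subset _ N)

lemma sum_classMass (N : Finset (Fin n)) : ∑ c, I.classMass c N = I.mass N :=
  Finset.sum_fiberwise N I.cls I.prob

lemma sum_mass_childNode (N : Finset (Fin n)) (t : Fin m) :
    ∑ v, I.mass (I.childNode N t v) = I.mass N :=
  I.sum_childNode I.prob N t

lemma sum_classMass_childNode (c : Fin k) (N : Finset (Fin n)) (t : Fin m) :
    ∑ v, I.classMass c (I.childNode N t v) = I.classMass c N := by
  rw [classMass, ← Finset.sum_fiberwise (N.filter fun i => I.cls i = c) (I.outcome t) I.prob]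
  refine Finset.sum_congr rfl fun v _ => ?_
  unfold classMass childNode
  rw [Finset.filter_comm]

lemma minProb_le_classMass {c : Fin k} {N : Finset (Fin n)} (h : I.classMass c N ≠ 0) :
    I.minProb ≤ I.classMass c N := by
  obtain ⟨i, hi⟩ : (N.filter fun i => I.cls i = c).Nonempty := by
    by_contra hne
    rw [Finset.not_nonempty_iff_eq_empty] at hne
    exact h (by rw [classMass, hne, Finset.sum_empty])
  exact (I.minProb_le i).trans
    (Finset.single_le_sum (f := I.prob) (fun j _ => (I.prob_pos j).le) hi)

lemma proportion_nonneg (c : Fin k) (N : Finset (Fin n)) : 0 ≤ I.classMass c N / I.mass N :=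
  div_nonneg (I.classMass_nonneg c N) (I.mass_nonneg N)

lemma proportion_le_one (c : Fin k) (N : Finset (Fin n)) : I.classMass c N / I.mass N ≤ 1 :=
  div_le_one_of_le₀ (I.classMass_le_mass c N) (I.mass_nonneg N)

lemma minProb_le_proportion {c : Fin k} {N : Finset (Fin n)} (h : I.classMass c N ≠ 0) :
    I.minProb ≤ I.classMass c N / I.mass N := by
  have h1 := I.minProb_le_classMass h
  have h0 : 0 < I.mass N := (I.minProb_pos.trans_le h1).trans_le (I.classMass_le_mass c N)
  rw [le_div_iff₀ h0]
  have := mul_le_mul h1 (I.mass_le_one N) h0.le (I.classMass_nonneg c N)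
  linarith

variable {φ : ℝ → ℝ} {B : ℝ}

lemma classScore_le (hφ : ScoreBound φ I.minProb B) {N : Finset (Fin n)} {i : Fin n}
    (hi : i ∈ N) : I.classScore φ (I.cls i) N ≤ B := by
  refine hφ.le _ (I.minProb_le_proportion ?_) (I.proportion_le_one _ _)
  have h : 0 < I.mass (N.filter fun j => I.cls j = I.cls i) := I.mass_pos ⟨i, by simp [hi]⟩
  exact h.ne'

lemma maxScore_le (hφ : ScoreBound φ I.minProb B) : I.maxScore φ ≤ B := by
  obtain ⟨i⟩ := I.nonempty_index
  have : Nonempty {x : Finset (Fin n) × Fin n // x.2 ∈ x.1} :=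
    ⟨⟨(Finset.univ, i), Finset.mem_univ i⟩⟩
  exact ciSup_le fun x => I.classScore_le hφ x.2

lemma impurity_nonneg (hφ : ScoreBound φ I.minProb B) (N : Finset (Fin n)) :
    0 ≤ I.impurity φ N :=
  Finset.sum_nonneg fun c _ => mul_nonneg (I.proportion_nonneg c N)
    (hφ.nonneg _ (I.proportion_nonneg c N) (I.proportion_le_one c N))

lemma impurity_le (hφ : ScoreBound φ I.minProb B) {N : Finset (Fin n)} (hN : 0 < I.mass N) :
    I.impurity φ N ≤ B := by
  have h : I.impurity φ N ≤ ∑ c, I.classMass c N / I.mass N * B := by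
    refine Finset.sum_le_sum fun c _ => ?_
    by_cases hc : I.classMass c N = 0
    · simp [hc]
    · exact mul_le_mul_of_nonneg_left
        (hφ.le _ (I.minProb_le_proportion hc) (I.proportion_le_one _ _))
        (I.proportion_nonneg c N)
  rw [← Finset.sum_mul, ← Finset.sum_div, I.sum_classMass, div_self hN.ne', one_mul] at h
  exact h

/-- Jensen's inequality for `x * φ x`, class by class: the proportion in `N` is the average of the
proportions in the children, weighted by their masses. -/
lemma impurityAfter_le_impurity (hφ : ScoreBound φ I.minProb B) {N : Finset (Fin n)}
    (hN : 0 < I.mass N) (t : Fin m) : I.impurityAfter φ N t ≤ I.impurity φ N := by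
  have hcomm : I.impurityAfter φ N t = ∑ c, ∑ v, I.mass (I.childNode N t v) / I.mass N *
      (I.classMass c (I.childNode N t v) / I.mass (I.childNode N t v) *
        φ (I.classMass c (I.childNode N t v) / I.mass (I.childNode N t v))) := by
    rw [Finset.sum_comm]
    exact Finset.sum_congr rfl fun v _ => by rw [← Finset.mul_sum]; rfl
  rw [hcomm]
  refine Finset.sum_le_sum fun c _ => ?_
  have h := hφ.concave.le_map_sum (t := Finset.univ)
    (w := fun v => I.mass (I.childNode N t v) / I.mass N)
    (p := fun v => I.classMass c (I.childNode N t v) / I.mass (I.childNode N t v))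
    (fun v _ => div_nonneg (I.mass_nonneg _) (I.mass_nonneg _))
    (by rw [← Finset.sum_div, I.sum_mass_childNode, div_self hN.ne'])
    (fun v _ => I.proportion_nonneg _ _)
  have e : ∑ v, (I.mass (I.childNode N t v) / I.mass N) •
      (I.classMass c (I.childNode N t v) / I.mass (I.childNode N t v)) =
      I.classMass c N / I.mass N := by
    rw [← I.sum_classMass_childNode c N t, Finset.sum_div]
    refine Finset.sum_congr rfl fun v _ => ?_
    rw [smul_eq_mul]
    -- In a child of mass zero the proportions are `0 / 0 = 0`, which is harmless because the class
    -- masses vanish too.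
    rcases (I.mass_nonneg (I.childNode N t v)).eq_or_lt with h0 | h0
    · have h1 : I.classMass c (I.childNode N t v) = 0 :=
        le_antisymm (h0 ▸ I.classMass_le_mass c _) (I.classMass_nonneg c _)
      simp [h1]
    · field_simp
  rw [e] at h
  exact h

lemma mass_mul_impurityAfter {N : Finset (Fin n)} (hN : 0 < I.mass N) (t : Fin m) :
    I.mass N * I.impurityAfter φ N t =
      ∑ v, I.mass (I.childNode N t v) * I.impurity φ (I.childNode N t v) := by
  unfold impurityAfter
  rw [Finset.mul_sum]
  refine Finset.sum_congr rfl fun v _ => ?_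
  field_simp

/-! Potential of a node -/

/-- Bound for the total relative decrease of the demand of `i` below the node `N`. -/
noncomputable def demand (i : Fin n) (N : Finset (Fin n)) : ℝ :=
  if I.residual i N = 0 then 0
  else if I.mass N - I.cap i < I.minProb then 1
  else 2 + Real.log ((n : ℝ) ^ 2 / I.minProb * I.residual i N)

/-- The mass factor is at least `p_min`, since dividing by `1 - cap ≤ 1` only enlarges it. The pair
factor is at least `1 / n ^ 2`, since some heterogeneous pair remains out of at most `n ^ 2`. -/
lemma one_le_sq_div_mul_residual {i : Fin n} {N : Finset (Fin n)} (hi : I.cap i < 1)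
    (hr : I.residual i N ≠ 0) (hm : I.minProb ≤ I.mass N - I.cap i) :
    1 ≤ (n : ℝ) ^ 2 / I.minProb * I.residual i N := by
  have hp := I.minProb_pos
  have hcap : 0 < I.cap i := (I.prob_pos i).trans_le (le_max_left _ _)
  have hN : I.hetPairs N ≠ 0 := by
    intro h0
    exact hr (by simp [residual, h0])
  have h1 : (1 : ℝ) ≤ I.hetPairs N := by exact_mod_cast Nat.one_le_iff_ne_zero.2 hN
  have hU : (1 : ℝ) ≤ I.hetPairs Finset.univ :=
    h1.trans (by exact_mod_cast I.hetPairs_mono (Finset.subset_univ N))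
  have hU2 : (I.hetPairs Finset.univ : ℝ) ≤ (n : ℝ) ^ 2 := by
    exact_mod_cast I.hetPairs_le_sq Finset.univ
  have a1 : I.minProb ≤ max ((I.mass N - I.cap i) / (1 - I.cap i)) 0 := by
    refine le_max_of_le_left (hm.trans ?_)
    rw [le_div_iff₀ (by linarith)]
    nlinarith
  have a2 : 1 / (n : ℝ) ^ 2 ≤ (I.hetPairs N : ℝ) / I.hetPairs Finset.univ := by
    gcongr
  have a3 : I.minProb * (1 / (n : ℝ) ^ 2) ≤ I.residual i N :=
    mul_le_mul a1 a2 (by positivity) (by positivity)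
  have hn : (0 : ℝ) < n := by exact_mod_cast i.pos
  calc (1 : ℝ) = (n : ℝ) ^ 2 / I.minProb * (I.minProb * (1 / (n : ℝ) ^ 2)) := by field_simp
    _ ≤ _ := by gcongr

lemma demand_nonneg {i : Fin n} (hi : I.cap i < 1) (N : Finset (Fin n)) : 0 ≤ I.demand i N := by
  unfold demand
  split_ifs with h1 h2
  · exact le_rfl
  · exact zero_le_one
  · have := Real.log_nonneg (I.one_le_sq_div_mul_residual hi h1 (not_lt.1 h2))
    linarith

lemma demand_le {i : Fin n} (hi : I.cap i < 1) (N : Finset (Fin n)) :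
    I.demand i N ≤ 2 + 2 * Real.log n + Real.log (1 / I.minProb) := by
  have hp := I.minProb_pos
  have hn : (0 : ℝ) < n := by exact_mod_cast i.pos
  have hn1 : (1 : ℝ) ≤ n := by exact_mod_cast i.pos
  have l1 : 0 ≤ Real.log n := Real.log_nonneg hn1
  have l2 : 0 ≤ Real.log (1 / I.minProb) :=
    Real.log_nonneg (by rw [le_div_iff₀ hp]; linarith [I.minProb_le_one])
  unfold demand
  split_ifs with h1 h2
  · linarith
  · linarith
  · have h3 : (n : ℝ) ^ 2 / I.minProb * I.residual i N ≤ (n : ℝ) ^ 2 * (1 / I.minProb) := by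
      rw [mul_one_div]
      exact mul_le_of_le_one_right (by positivity) (I.residual_le_one hi N)
    have h4 := Real.log_le_log
      (zero_lt_one.trans_le (I.one_le_sq_div_mul_residual hi h1 (not_lt.1 h2))) h3
    have h5 : Real.log ((n : ℝ) ^ 2 * (1 / I.minProb)) =
        2 * Real.log n + Real.log (1 / I.minProb) := by
      rw [Real.log_mul (by positivity) (by positivity), Real.log_pow]
      norm_cast
    linarith

/-- With an arbitrary threshold the residual can be positive yet arbitrarily small, so the usual
logarithmic bound alone does not suffice. Once the mass exceeds the cap by less than `p_min`,
however, losing any object brings the residual to zero, so only one more unit can be gained. The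
constant 2 in `demand` pays for the step into this regime and for the unit still due there. -/
lemma demand_step {i : Fin n} {N N' : Finset (Fin n)} (hN : ¬ I.Stops N) (hi : i ∈ N)
    (hsub : N' ⊆ N) :
    (I.residual i N - I.residual i N') / I.residual i N + I.demand i N' ≤ I.demand i N := by
  have hc := I.cap_lt_one hN hi
  have hr := I.residual_pos hN hi
  have hp := I.minProb_pos
  have hfrac : (I.residual i N - I.residual i N') / I.residual i N ≤ 1 := by
    rw [div_le_one hr]
    linarith [I.residual_nonneg i N']
  by_cases hm : I.mass N - I.cap i < I.minProb
  · rcases hsub.eq_or_ssubset with rfl | hss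
    · simp
    · have h0 : I.residual i N' = 0 := by
        unfold residual
        rw [max_eq_right, zero_mul]
        refine div_nonpos_of_nonpos_of_nonneg ?_ (by linarith)
        linarith [I.mass_add_minProb_le hss]
      have e1 : I.demand i N' = 0 := by simp [demand, h0]
      have e2 : I.demand i N = 1 := by simp [demand, hr.ne', hm]
      linarith
  · have e2 : I.demand i N = 2 + Real.log ((n : ℝ) ^ 2 / I.minProb * I.residual i N) := by
      simp [demand, hr.ne', hm]
    have hlog := Real.log_nonneg (I.one_le_sq_div_mul_residual hc hr.ne' (not_lt.1 hm))
    by_cases h0 : I.residual i N' = 0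
    · have e1 : I.demand i N' = 0 := by simp [demand, h0]
      linarith
    by_cases hm' : I.mass N' - I.cap i < I.minProb
    · have e1 : I.demand i N' = 1 := by simp [demand, h0, hm']
      linarith
    have e1 : I.demand i N' = 2 + Real.log ((n : ℝ) ^ 2 / I.minProb * I.residual i N') := by
      simp [demand, h0, hm']
    have hr' : 0 < I.residual i N' := lt_of_le_of_ne (I.residual_nonneg i N') (Ne.symm h0)
    have hn : (0 : ℝ) < n := by exact_mod_cast i.pos
    rw [e1, e2, Real.log_mul (by positivity) hr.ne', Real.log_mul (by positivity) hr'.ne']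
    -- The inequality `log x ≤ x - 1` at the ratio of the residuals bounds the relative drop by the
    -- drop of the logarithm.
    have h := Real.log_le_sub_one_of_pos (div_pos hr' hr)
    rw [Real.log_div hr'.ne' hr.ne'] at h
    rw [sub_div, div_self hr.ne']
    linarith

/-- Bound for the total greedy gain below the node `N`. -/
noncomputable def potential (φ : ℝ → ℝ) (lam : ℝ) (N : Finset (Fin n)) : ℝ :=
  ∑ i ∈ N, I.prob i * (Real.log N.card / Real.log 2 + I.demand i N) +
    lam * (I.mass N * I.impurity φ N)

/-- A child other than the chosen largest one is disjoint from it and no larger, hence has at most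
half of the objects: leaving costs one unit of `log₂`. -/
lemma log_card_child_step {N : Finset (Fin n)} {t : Fin m} {big : Fin (I.arity t)}
    (hbig : ∀ v, (I.childNode N t v).card ≤ (I.childNode N t big).card) {i : Fin n}
    (hi : i ∈ N) :
    (if I.outcome t i = big then (0 : ℝ) else 1) +
      Real.log (I.childNode N t (I.outcome t i)).card / Real.log 2 ≤
      Real.log N.card / Real.log 2 := by
  have hl : 0 < Real.log 2 := Real.log_pos one_lt_two
  have hpos : 0 < (I.childNode N t (I.outcome t i)).card :=
    Finset.card_pos.2 ⟨i, by simp [hi]⟩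
  have hpos' : (0 : ℝ) < (I.childNode N t (I.outcome t i)).card := by exact_mod_cast hpos
  split_ifs with h
  · rw [zero_add]
    gcongr
    exact I.childNode_subset _ _ _
  · have hd : Disjoint (I.childNode N t (I.outcome t i)) (I.childNode N t big) := by
      rw [Finset.disjoint_left]
      intro j
      simp only [mem_childNode]
      rintro ⟨-, h1⟩ ⟨-, h2⟩
      exact h (h1.symm.trans h2)
    have h1 := Finset.card_le_card
      (Finset.union_subset (I.childNode_subset N t (I.outcome t i)) (I.childNode_subset N t big))
    rw [Finset.card_union_of_disjoint hd] at h1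
    have h2 := hbig (I.outcome t i)
    have h3 : (2 : ℝ) * (I.childNode N t (I.outcome t i)).card ≤ N.card := by
      exact_mod_cast (by omega : 2 * (I.childNode N t (I.outcome t i)).card ≤ N.card)
    have h4 := Real.log_le_log (by positivity) h3
    rw [Real.log_mul two_ne_zero hpos'.ne'] at h4
    rw [show (1 : ℝ) = Real.log 2 / Real.log 2 from (div_self hl.ne').symm, ← add_div]
    gcongr

lemma mass_sub_mass_childNode (N : Finset (Fin n)) (t : Fin m) (big : Fin (I.arity t)) :
    I.mass N - I.mass (I.childNode N t big) =
      ∑ i ∈ N, I.prob i * (if I.outcome t i = big then (0 : ℝ) else 1) := by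
  unfold mass childNode
  rw [Finset.sum_filter, ← Finset.sum_sub_distrib]
  refine Finset.sum_congr rfl fun i _ => ?_
  split_ifs <;> simp

/-- The gain of a test at a node without the impurity term. -/
noncomputable def coverGain (N : Finset (Fin n)) (t : Fin m) (v : Fin (I.arity t)) : ℝ :=
  I.mass N - I.mass (I.childNode N t v) + ∑ i ∈ N, I.prob i *
    ((I.residual i N - I.residual i (I.childNode N t (I.outcome t i))) / I.residual i N)

/-- Each of the three parts of the gain is paid by its own part of the potential: branch sizes and
residuals object by object, impurity through the identity for mass times impurity. -/
lemma gain_add_potential_le (lam : ℝ) {N : Finset (Fin n)} (hN : ¬ I.Stops N)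
    (hpos : 0 < I.mass N) {t : Fin m} {big : Fin (I.arity t)}
    (hbig : ∀ v, (I.childNode N t v).card ≤ (I.childNode N t big).card) :
    I.coverGain N t big + lam * I.mass N * (I.impurity φ N - I.impurityAfter φ N t) +
      ∑ v, I.potential φ lam (I.childNode N t v) ≤ I.potential φ lam N := by
  have e1 : ∑ v, I.potential φ lam (I.childNode N t v) =
      ∑ i ∈ N, I.prob i * (Real.log (I.childNode N t (I.outcome t i)).card / Real.log 2 +
        I.demand i (I.childNode N t (I.outcome t i))) +
      lam * (I.mass N * I.impurityAfter φ N t) := by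
    unfold potential
    rw [Finset.sum_add_distrib, ← Finset.mul_sum, I.mass_mul_impurityAfter hpos,
      ← I.sum_childNode _ N t]
    congr 1
    refine Finset.sum_congr rfl fun v _ => Finset.sum_congr rfl fun i hi => ?_
    rw [(I.mem_childNode.1 hi).2]
  rw [e1, coverGain, mass_sub_mass_childNode, potential]
  have key : ∑ i ∈ N, I.prob i * (if I.outcome t i = big then (0 : ℝ) else 1) +
      ∑ i ∈ N, I.prob i *
        ((I.residual i N - I.residual i (I.childNode N t (I.outcome t i))) / I.residual i N) +
      ∑ i ∈ N, I.prob i * (Real.log (I.childNode N t (I.outcome t i)).card / Real.log 2 +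
        I.demand i (I.childNode N t (I.outcome t i))) ≤
      ∑ i ∈ N, I.prob i * (Real.log N.card / Real.log 2 + I.demand i N) := by
    rw [← Finset.sum_add_distrib, ← Finset.sum_add_distrib]
    refine Finset.sum_le_sum fun i hi => ?_
    rw [← mul_add, ← mul_add]
    refine mul_le_mul_of_nonneg_left ?_ (I.prob_pos i).le
    have h1 := I.log_card_child_step hbig hi
    have h2 := I.demand_step hN hi (I.childNode_subset N t (I.outcome t i))
    linarith
  linarith

lemma potential_nonneg (hφ : ScoreBound φ I.minProb B) (hcap : ∀ i, I.cap i < 1) {lam : ℝ}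
    (hlam : 0 ≤ lam) (N : Finset (Fin n)) : 0 ≤ I.potential φ lam N := by
  have hl : 0 < Real.log 2 := Real.log_pos one_lt_two
  refine add_nonneg (Finset.sum_nonneg fun i hi => mul_nonneg (I.prob_pos i).le ?_)
    (mul_nonneg hlam (mul_nonneg (I.mass_nonneg N) (I.impurity_nonneg hφ N)))
  exact add_nonneg (div_nonneg (Real.log_natCast_nonneg _) hl.le) (I.demand_nonneg (hcap i) N)

lemma potential_le (hφ : ScoreBound φ I.minProb B) (hcap : ∀ i, I.cap i < 1) {lam : ℝ}
    (hlam : 0 ≤ lam) {N : Finset (Fin n)} (hN : 0 < I.mass N) :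
    I.potential φ lam N ≤ I.mass N *
      (Real.log n / Real.log 2 + (2 + 2 * Real.log n + Real.log (1 / I.minProb)) + lam * B) := by
  have hl : 0 < Real.log 2 := Real.log_pos one_lt_two
  have h1 : ∑ i ∈ N, I.prob i * (Real.log N.card / Real.log 2 + I.demand i N) ≤
      ∑ i ∈ N, I.prob i *
        (Real.log n / Real.log 2 + (2 + 2 * Real.log n + Real.log (1 / I.minProb))) := by
    refine Finset.sum_le_sum fun i hi => mul_le_mul_of_nonneg_left ?_ (I.prob_pos i).le
    refine add_le_add ?_ (I.demand_le (hcap i) N)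
    have hc : (0 : ℝ) < N.card := by exact_mod_cast Finset.card_pos.2 ⟨i, hi⟩
    have hc' : (N.card : ℝ) ≤ n := by exact_mod_cast (by simpa using Finset.card_le_univ N)
    gcongr
  rw [← Finset.sum_mul] at h1
  have h2 := mul_le_mul_of_nonneg_left
    (mul_le_mul_of_nonneg_left (I.impurity_le hφ hN) hN.le) hlam
  unfold potential
  change _ ≤ I.mass N * _ at h1
  linarith

variable {φ : ℝ → ℝ} {B : ℝ}

/-! Greedy scores -/

/-- Every object is eventually covered by the tests. -/
def Solvable : Prop := ∀ i, I.Stops (I.agreeing i Finset.univ)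

lemma Feasible.solvable {T : DecisionTree k I.arity} (hT : I.Feasible T) : I.Solvable :=
  fun _ => I.stops_agreeing_univ_of_feasibleOn hT (Finset.subset_univ _)

/-- Solvability makes `f_i` equal to 1 on the set of all tests, so the denominator in the score is
exactly the current residual. -/
lemma cost_mul_score (hI : I.Solvable) (lam : ℝ) {N : Finset (Fin n)} {S : Finset (Fin m)}
    (hN : ¬ I.Stops N) (hNS : I.Reached N S) (t : Fin m) (v : Fin (I.arity t)) :
    (I.cost t : ℝ) * I.score φ lam N S t v =
      I.coverGain N t v + lam * I.mass N * (I.impurity φ N - I.impurityAfter φ N t) := by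
  have hc : (I.cost t : ℝ) ≠ 0 := by exact_mod_cast (I.cost_pos t).ne'
  have hh := I.hetPairs_univ_pos hN
  have e : ∀ i ∈ N, I.prob i * ((I.orCover i (insert t S) - I.orCover i S) /
      (I.orCover i Finset.univ - I.orCover i S)) = I.prob i *
      ((I.residual i N - I.residual i (I.childNode N t (I.outcome t i))) / I.residual i N) := by
    intro i hi
    have hcap := I.cap_lt_one hN hi
    rw [I.orCover_eq hcap hh, I.orCover_eq hcap hh, I.orCover_eq hcap hh, agreeing_insert,
      hNS i hi, I.residual_eq_zero_of_stops hcap (hI i)]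
    congr 2 <;> ring
  unfold score coverGain
  rw [Finset.sum_congr rfl e]
  field_simp

lemma coverGain_nonneg {N : Finset (Fin n)} (hcap : ∀ i, I.cap i < 1) (t : Fin m)
    (v : Fin (I.arity t)) : 0 ≤ I.coverGain N t v := by
  refine add_nonneg (sub_nonneg.2 (I.mass_mono (I.childNode_subset N t v)))
    (Finset.sum_nonneg fun i _ => mul_nonneg (I.prob_pos i).le
      (div_nonneg (sub_nonneg.2 ?_) (I.residual_nonneg i N)))
  exact I.residual_mono (hcap i) (I.childNode_subset N t _)

/-- The comparison tree may repeat tests that greedy has already used on the way to `N`, and greedy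
maximizes over unused ones only. Used tests no longer split `N`, so they do not spoil the
comparison. -/
lemma coverGain_eq_zero_of_mem {N : Finset (Fin n)} {S : Finset (Fin m)}
    (hNS : I.Reached N S) (hne : N.Nonempty) {t : Fin m} (ht : t ∈ S) {v : Fin (I.arity t)}
    (hv : ∀ w, (I.childNode N t w).card ≤ (I.childNode N t v).card) :
    I.coverGain N t v = 0 := by
  have hall : ∀ i ∈ N, I.childNode N t (I.outcome t i) = N := by
    intro i hi
    rw [childNode, Finset.filter_eq_self]
    intro j hj
    rw [← hNS i hi, mem_agreeing] at hj
    exact hj t ht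
  obtain ⟨i, hi⟩ := hne
  have hbig : I.childNode N t v = N := by
    refine Finset.eq_of_subset_of_card_le (I.childNode_subset N t v) ?_
    have := hv (I.outcome t i)
    rwa [hall i hi] at this
  unfold coverGain
  rw [hbig, sub_self, zero_add]
  refine Finset.sum_eq_zero fun j hj => ?_
  rw [hall j hj]
  simp

/-- Along the path of largest branches in a feasible tree, objects are either separated or
covered. -/
lemma mass_done_le_of_feasibleOn {N : Finset (Fin n)} (hN : ¬ I.Stops N)
    (hcap : ∀ i, I.cap i < 1) {big : (s : Fin m) → Fin (I.arity s)} {σ : ℝ} (hσ : 0 ≤ σ)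
    (hbest : ∀ s, I.coverGain N s (big s) ≤ I.cost s * σ)
    (T : DecisionTree k I.arity) :
    ∀ (X H : Finset (Fin n)) (τ : ℝ), I.FeasibleOn T X → H ⊆ N → H ⊆ X → 0 ≤ τ →
      I.mass (H.filter fun i => (I.pathCost T i : ℝ) ≤ τ) ≤
        τ * σ + ∑ i ∈ H, I.prob i * ((I.residual i N - I.residual i (N ∩ X)) / I.residual i N) := by
  have hfrac : ∀ (H X : Finset (Fin n)),
      0 ≤ ∑ i ∈ H, I.prob i * ((I.residual i N - I.residual i (N ∩ X)) / I.residual i N) :=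
    fun H X => Finset.sum_nonneg fun i _ => mul_nonneg (I.prob_pos i).le
      (div_nonneg (sub_nonneg.2 (I.residual_mono (hcap i) Finset.inter_subset_left))
        (I.residual_nonneg i N))
  induction T with
  | leaf c =>
    intro X H τ hT hHN hHX hτ
    -- At a feasible leaf the residual of every object still on the path is zero, so the coverage
    -- sum equals the whole mass of `H`.
    have hX : I.Stops (N ∩ X) := Stops.mono I (I.stops_iff.2 hT) Finset.inter_subset_right
    have e : ∑ i ∈ H, I.prob i * ((I.residual i N - I.residual i (N ∩ X)) / I.residual i N) =
        I.mass H := by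
      refine Finset.sum_congr rfl fun i hi => ?_
      rw [I.residual_eq_zero_of_stops (hcap i) hX, sub_zero,
        div_self (I.residual_pos hN (hHN hi)).ne', mul_one]
    rw [e]
    have := I.mass_mono (Finset.filter_subset
      (fun i => ((I.pathCost (DecisionTree.leaf c) i : ℕ) : ℝ) ≤ τ) H)
    have := mul_nonneg hτ hσ
    linarith
  | node s child ih =>
    intro X H τ hT hHN hHX hτ
    by_cases hs : (I.cost s : ℝ) ≤ τ
    swap
    -- The next test alone exceeds the budget, so no object of `H` finishes within it.
    · have e : (H.filter fun i => ((I.pathCost (DecisionTree.node s child) i : ℕ) : ℝ) ≤ τ) = ∅ := by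
        rw [Finset.filter_eq_empty_iff]
        intro i _ hle
        apply hs
        refine le_trans ?_ hle
        simp only [pathCost]
        push_cast
        linarith [Nat.cast_nonneg (α := ℝ) (I.pathCost (child (I.outcome s i)) i)]
      rw [e]
      have h1 := hfrac H X
      have := mul_nonneg hτ hσ
      simp only [mass, Finset.sum_empty]
      linarith
    set H' := I.childNode H s (big s) with hH'
    have hH'H : H' ⊆ H := I.childNode_subset _ _ _
    have IH := ih (big s) (I.childNode X s (big s)) H' (τ - I.cost s) (hT (big s))
      (hH'H.trans hHN) (Finset.filter_subset_filter _ hHX) (by linarith)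
    -- Objects finishing in time either leave the largest branch of `N` or continue along it with
    -- the budget reduced by the cost of `s`.
    have hsub : (H.filter fun i => ((I.pathCost (DecisionTree.node s child) i : ℕ) : ℝ) ≤ τ) ⊆
        (N \ I.childNode N s (big s)) ∪
        (H'.filter fun i => (I.pathCost (child (big s)) i : ℝ) ≤ τ - I.cost s) := by
      intro i hmem
      obtain ⟨hi, hle⟩ := Finset.mem_filter.1 hmem
      simp only [pathCost] at hle
      simp only [Finset.mem_filter, Finset.mem_union, Finset.mem_sdiff, hH', mem_childNode]
      by_cases ho : I.outcome s i = big s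
      · refine .inr ⟨⟨hi, ho⟩, ?_⟩
        rw [ho] at hle
        push_cast at hle
        linarith
      · exact .inl ⟨hHN hi, fun h => ho h.2⟩
    have hmass := (I.mass_mono hsub).trans (Finset.sum_union_inter (f := I.prob) ▸
      le_add_of_nonneg_right (I.mass_nonneg _))
    change _ ≤ I.mass _ + I.mass _ at hmass
    rw [I.mass_sdiff (I.childNode_subset _ _ _)] at hmass
    have hsplit : ∑ i ∈ H', I.prob i *
        ((I.residual i N - I.residual i (N ∩ I.childNode X s (big s))) / I.residual i N) ≤
        ∑ i ∈ H, I.prob i * ((I.residual i N - I.residual i (N ∩ X)) / I.residual i N) +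
        ∑ i ∈ N, I.prob i * ((I.residual i N -
          I.residual i (I.childNode N s (I.outcome s i))) / I.residual i N) := by
      have h1 : ∑ i ∈ H', I.prob i *
          ((I.residual i N - I.residual i (N ∩ I.childNode X s (big s))) / I.residual i N) ≤
          ∑ i ∈ H', (I.prob i * ((I.residual i N - I.residual i (N ∩ X)) / I.residual i N) +
            I.prob i * ((I.residual i N - I.residual i (I.childNode N s (I.outcome s i))) /
              I.residual i N)) := by
        refine Finset.sum_le_sum fun i hi => ?_
        have ho : I.outcome s i = big s := (I.mem_childNode.1 hi).2
        rw [← mul_add, ← add_div]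
        refine mul_le_mul_of_nonneg_left ?_ (I.prob_pos i).le
        refine div_le_div_of_nonneg_right ?_ (I.residual_nonneg i N)
        -- The test reduces the residual within `N ∩ X` by no more than it would at `N` itself,
        -- which is what `coverGain` measures.
        have h := I.residual_supermodular (hcap i)
          (Finset.inter_subset_left : N ∩ X ⊆ N) (I.childNode N s (big s))
        have e1 : N ∩ X ∩ I.childNode N s (big s) = N ∩ I.childNode X s (big s) := by
          ext j
          simp only [Finset.mem_inter, mem_childNode]
          tauto
        rw [e1, Finset.inter_eq_right.2 (I.childNode_subset _ _ _)] at h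
        rw [ho]
        linarith
      rw [Finset.sum_add_distrib] at h1
      refine h1.trans (add_le_add ?_ ?_)
      · refine Finset.sum_le_sum_of_subset_of_nonneg hH'H fun i _ _ => ?_
        exact mul_nonneg (I.prob_pos i).le
          (div_nonneg (sub_nonneg.2 (I.residual_mono (hcap i) Finset.inter_subset_left))
            (I.residual_nonneg i N))
      · refine Finset.sum_le_sum_of_subset_of_nonneg (hH'H.trans hHN) fun i _ _ => ?_
        exact mul_nonneg (I.prob_pos i).le
          (div_nonneg (sub_nonneg.2 (I.residual_mono (hcap i) (I.childNode_subset N s _)))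
            (I.residual_nonneg i N))
    have hb := hbest s
    unfold coverGain at hb
    linarith

/-- The greedy choice gains at a rate that is bounded below in terms of any feasible tree. -/
lemma mass_done_le_mul_score (hI : I.Solvable) (hφ : ScoreBound φ I.minProb B)
    {lam : ℝ} (hlam : 0 ≤ lam) (hcap : ∀ i, I.cap i < 1) {N : Finset (Fin n)}
    {S : Finset (Fin m)} (hN : ¬ I.Stops N) (hNS : I.Reached N S) (hne : N.Nonempty)
    {big : (s : Fin m) → Fin (I.arity s)}
    (hbig : ∀ s v, (I.childNode N s v).card ≤ (I.childNode N s (big s)).card) {t : Fin m}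
    (ht : ∀ s, s ∉ S → I.score φ lam N S s (big s) ≤ I.score φ lam N S t (big t))
    {T' : DecisionTree k I.arity} (hT' : I.Feasible T') {τ : ℝ} (hτ : 0 ≤ τ) :
    I.mass (N.filter fun i => (I.pathCost T' i : ℝ) ≤ τ) ≤
      τ * I.score φ lam N S t (big t) := by
  have hcost : ∀ s, (0 : ℝ) < I.cost s := fun s => by exact_mod_cast I.cost_pos s
  have himp : ∀ s, 0 ≤ lam * I.mass N * (I.impurity φ N - I.impurityAfter φ N s) := fun s =>
    mul_nonneg (mul_nonneg hlam (I.mass_nonneg N))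
      (sub_nonneg.2 (I.impurityAfter_le_impurity hφ (I.mass_pos hne) s))
  have hσ : 0 ≤ I.score φ lam N S t (big t) := by
    refine nonneg_of_mul_nonneg_right ?_ (hcost t)
    rw [I.cost_mul_score hI lam hN hNS]
    exact add_nonneg (I.coverGain_nonneg hcap t _) (himp t)
  -- At the root of `T'` the set `X` is everything, so the initial coverage sum vanishes.
  have h := I.mass_done_le_of_feasibleOn hN hcap (big := big) hσ ?_ T' Finset.univ N τ hT'
    subset_rfl (Finset.subset_univ N) hτ
  · simpa using h
  · intro s
    by_cases hs : s ∈ S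
    · rw [I.coverGain_eq_zero_of_mem hNS hne hs (hbig s)]
      exact mul_nonneg (hcost s).le hσ
    · have h1 := mul_le_mul_of_nonneg_left (ht s hs) (hcost s).le
      rw [I.cost_mul_score hI lam hN hNS] at h1
      linarith [himp s]

/-! Analysis of a run -/

lemma max_zero_sub_ge (x d c : ℝ) (hc : 0 ≤ c) :
    max 0 (x - (d + c)) + (if x ≤ d + c then 0 else c) ≤ max 0 (x - d) := by
  split_ifs with h
  · rw [max_eq_left (by linarith)]
    simp
  · push Not at h
    rw [max_eq_right (by linarith), max_eq_right (by linarith)]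
    linarith

/-- Here `d` stands for the cost already spent above `N`. Keeping the excess over `d` of the scaled
costs of `T'` lets the induction charge each test of the run to the objects that `T'` has not
finished by the scaled time. -/
lemma GreedyRun.cost_bound (hI : I.Solvable) (hφ : ScoreBound φ I.minProb B)
    {lam : ℝ} (hlam : 0 ≤ lam) (hcap : ∀ i, I.cap i < 1)
    {T' : DecisionTree k I.arity} (hT' : I.Feasible T') {G L : ℝ} (hL : 0 < L)
    (hG : ∀ N, 0 < I.mass N → I.potential φ lam N ≤ I.mass N * G)
    {N : Finset (Fin n)} {S : Finset (Fin m)} {T : DecisionTree k I.arity}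
    (hrun : I.GreedyRun φ lam N S T) (hNS : I.Reached N S) {d : ℝ} (hd : 0 ≤ d) :
    L * ∑ i ∈ N, I.prob i * (I.pathCost T i : ℝ) -
        L * ∑ i ∈ N, I.prob i * max 0 (L * (I.pathCost T' i : ℝ) - d) ≤
      d * I.potential φ lam N + G * ∑ i ∈ N, I.prob i * (I.pathCost T i : ℝ) := by
  induction hrun generalizing d with
  | leaf N S c hdone hmaj =>
    have h1 : 0 ≤ L * ∑ i ∈ N, I.prob i * max 0 (L * (I.pathCost T' i : ℝ) - d) :=
      mul_nonneg hL.le (Finset.sum_nonneg fun i _ =>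
        mul_nonneg (I.prob_pos i).le (le_max_left _ _))
    have h2 := mul_nonneg hd (I.potential_nonneg hφ hcap hlam N)
    simp only [pathCost, Nat.cast_zero, mul_zero, Finset.sum_const_zero]
    linarith
  | node N S t child hgo ht hchild ih =>
    obtain ⟨big, hbig, htS, hmax⟩ := ht
    have hne : N.Nonempty := by
      rw [Finset.nonempty_iff_ne_empty]
      rintro rfl
      exact hgo (.inl fun i hi => absurd hi (Finset.notMem_empty i))
    have hpos := I.mass_pos hne
    have hc : (0 : ℝ) < I.cost t := by exact_mod_cast I.cost_pos t
    set c : ℝ := (I.cost t : ℝ) with hcdef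
    set σ := I.score φ lam N S t (big t) with hσdef
    have hgain := I.gain_add_potential_le (φ := φ) lam hgo hpos (hbig t)
    rw [← I.cost_mul_score hI lam hgo hNS] at hgain
    -- The time `(d + c) / L` is where the scaled cost of an object in `T'` equals the greedy cost
    -- after the test; only objects finished by then escape the charge to the excess.
    have hdone := I.mass_done_le_mul_score hI hφ hlam hcap hgo hNS hne hbig hmax hT'
      (τ := (d + c) / L) (by positivity)
    have hsum := Finset.sum_le_sum fun (v : Fin (I.arity t)) (_ : v ∈ Finset.univ) =>
      ih v (hNS.child I t v) (d := d + c) (by linarith)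
    rw [Finset.sum_sub_distrib, Finset.sum_add_distrib, ← Finset.mul_sum, ← Finset.mul_sum,
      ← Finset.mul_sum, ← Finset.mul_sum, I.sum_childNode] at hsum
    have hA : ∑ v, ∑ i ∈ I.childNode N t v, I.prob i * (I.pathCost (child v) i : ℝ) =
        ∑ i ∈ N, I.prob i * (I.pathCost (child (I.outcome t i)) i : ℝ) := by
      rw [← I.sum_childNode _ N t]
      refine Finset.sum_congr rfl fun v _ => Finset.sum_congr rfl fun i hi => ?_
      rw [(I.mem_childNode.1 hi).2]
    rw [hA] at hsum
    have hB : ∑ i ∈ N, I.prob i * (I.pathCost (DecisionTree.node t child) i : ℝ) =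
        c * I.mass N + ∑ i ∈ N, I.prob i * (I.pathCost (child (I.outcome t i)) i : ℝ) := by
      rw [mass, Finset.mul_sum, ← Finset.sum_add_distrib]
      refine Finset.sum_congr rfl fun i _ => ?_
      simp only [pathCost]
      push_cast
      ring
    rw [hB]
    have hM : ∑ i ∈ N, I.prob i * max 0 (L * (I.pathCost T' i : ℝ) - (d + c)) +
        c * (I.mass N - I.mass (N.filter fun i => (I.pathCost T' i : ℝ) ≤ (d + c) / L)) ≤
        ∑ i ∈ N, I.prob i * max 0 (L * (I.pathCost T' i : ℝ) - d) := by
      unfold mass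
      rw [Finset.sum_filter, ← Finset.sum_sub_distrib, Finset.mul_sum, ← Finset.sum_add_distrib]
      refine Finset.sum_le_sum fun i _ => ?_
      have h := mul_le_mul_of_nonneg_left
        (max_zero_sub_ge (L * (I.pathCost T' i : ℝ)) d c hc.le) (I.prob_pos i).le
      have hiff : (I.pathCost T' i : ℝ) ≤ (d + c) / L ↔ L * (I.pathCost T' i : ℝ) ≤ d + c := by
        rw [le_div_iff₀ hL, mul_comm]
      simp only [hiff]
      split_ifs at h ⊢ <;> linarith
    have hM' := mul_le_mul_of_nonneg_left hM hL.le
    have hdone' := mul_le_mul_of_nonneg_left hdone (mul_nonneg hc.le hL.le)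
    have e : c * L * ((d + c) / L * σ) = (d + c) * (c * σ) := by field_simp
    rw [← hσdef, e] at hdone'
    -- The weight `d + c` matches the one on the children's potentials in the induction hypothesis.
    -- What is left is `d` times the potential of `N`, plus `c` times it, and the latter is at most
    -- `G` times the expected cost of this test on `N`.
    have hgain' := mul_le_mul_of_nonneg_left hgain (by linarith : 0 ≤ d + c)
    have hpot := mul_le_mul_of_nonneg_left (hG N hpos) hc.le
    linarith

lemma GreedyRun.expectedCost_le (hφ : ScoreBound φ I.minProb B)
    {lam : ℝ} (hlam : 0 ≤ lam) (hcap : ∀ i, I.cap i < 1)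
    {T T' : DecisionTree k I.arity} (hT : I.IsGreedyOutput φ lam T) (hT' : I.Feasible T')
    {G : ℝ} (hG0 : 0 < G) (hG : ∀ N, 0 < I.mass N → I.potential φ lam N ≤ I.mass N * G) :
    I.expectedCost T ≤ 4 * G * I.expectedCost T' := by
  -- At the root `d = 0` removes the potential term, and `L = 2 * G` lets half of the left side
  -- absorb `G` times the greedy cost.
  have h := GreedyRun.cost_bound I (Feasible.solvable I hT') hφ hlam hcap hT'
    (by linarith : 0 < 2 * G) hG hT I.reached_univ le_rfl
  have e : ∑ i, I.prob i * max 0 (2 * G * (I.pathCost T' i : ℝ) - 0) =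
      2 * G * I.expectedCost T' := by
    rw [expectedCost, Finset.mul_sum]
    refine Finset.sum_congr rfl fun i _ => ?_
    rw [sub_zero, max_eq_right (by positivity)]
    ring
  rw [e] at h
  change 2 * G * I.expectedCost T - _ ≤ _ + G * I.expectedCost T at h
  have h2 : G * I.expectedCost T ≤ G * (4 * G * I.expectedCost T') := by linarith
  exact le_of_mul_le_mul_left h2 hG0

/-! Existence and feasibility of outputs -/

lemma GreedyRun.feasibleOn {lam : ℝ} {N : Finset (Fin n)} {S : Finset (Fin m)}
    {T : DecisionTree k I.arity} (h : I.GreedyRun φ lam N S T) : I.FeasibleOn T N := by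
  induction h with
  | leaf N S c hdone hmaj => exact I.stops_iff.1 hdone
  | node N S t child hgo ht hchild ih => exact ih

/-- Tests cannot run out before the stopping rule applies: a nonempty node reached by all tests is a
full agreement class, which stops by solvability. The number of unused tests decreases along the
recursion. -/
lemma exists_greedyRun (hI : I.Solvable) (lam : ℝ) (N : Finset (Fin n)) (S : Finset (Fin m))
    (hNS : I.Reached N S) : ∃ T, I.GreedyRun φ lam N S T := by
  obtain ⟨i₀⟩ := I.nonempty_index
  by_cases hN : I.Stops N
  · obtain ⟨c, -, hc⟩ := Finset.exists_max_image Finset.univ (fun c => I.classMass c N)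
      ⟨I.cls i₀, Finset.mem_univ _⟩
    exact ⟨_, .leaf N S c hN fun c' => hc c' (Finset.mem_univ _)⟩
  · have hb : ∀ s, ∃ b, ∀ v, (I.childNode N s v).card ≤ (I.childNode N s b).card := by
      intro s
      obtain ⟨b, -, hb⟩ := Finset.exists_max_image Finset.univ
        (fun v => (I.childNode N s v).card) ⟨I.outcome s i₀, Finset.mem_univ _⟩
      exact ⟨b, fun v => hb v (Finset.mem_univ _)⟩
    choose big hbig using hb
    have hSne : Sᶜ.Nonempty := by
      rw [Finset.nonempty_iff_ne_empty]
      intro h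
      rw [Finset.compl_eq_empty_iff] at h
      subst h
      rcases N.eq_empty_or_nonempty with rfl | ⟨i, hi⟩
      · exact hN (.inl fun i hi => absurd hi (Finset.notMem_empty i))
      · exact hN (hNS i hi ▸ hI i)
    obtain ⟨t, ht, hmax⟩ := Finset.exists_max_image Sᶜ
      (fun s => I.score φ lam N S s (big s)) hSne
    have hdec : (Sᶜ.erase t).card < Sᶜ.card := Finset.card_erase_lt_of_mem ht
    choose child hchild using fun v =>
      exists_greedyRun hI lam (I.childNode N t v) (insert t S) (hNS.child I t v)
    exact ⟨_, .node N S t child hN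
      ⟨big, hbig, Finset.mem_compl.1 ht, fun s hs => hmax s (Finset.mem_compl.2 hs)⟩ hchild⟩
termination_by Sᶜ.card

/-! ### Numerical constants and the approximation ratio -/

/-- The factor 2 serves both scores at once: the Gini bound 1 is below `2 * log 2`. -/
lemma scoreBound_of_eq (hφ : φ = entropyScore ∨ φ = giniScore)
    (hp : I.minProb ≤ 1 / 2) : ScoreBound φ I.minProb (2 * Real.log (1 / I.minProb)) := by
  have h2 : Real.log 2 ≤ Real.log (1 / I.minProb) := by
    refine Real.log_le_log two_pos ?_
    rw [le_div_iff₀ I.minProb_pos]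
    linarith
  have h3 := Real.log_two_gt_d9
  rcases hφ with rfl | rfl
  · exact (scoreBound_entropyScore I.minProb_pos).mono (by linarith)
  · exact (scoreBound_giniScore I.minProb_pos.le).mono (by linarith)

lemma IsGreedyOutput.expectedCost_le (hφ : φ = entropyScore ∨ φ = giniScore) {lam : ℝ}
    (hlam : 0 ≤ lam) {T T' : DecisionTree k I.arity} (hT : I.IsGreedyOutput φ lam T)
    (hT' : I.Feasible T') :
    I.expectedCost T ≤
      40 * (1 + lam) * (Real.log (1 / I.minProb) + Real.log n) * I.expectedCost T' := by
  have hOPT : 0 ≤ I.expectedCost T' :=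
    Finset.sum_nonneg fun i _ => mul_nonneg (I.prob_pos i).le (Nat.cast_nonneg _)
  have hlog0 : 0 ≤ Real.log (1 / I.minProb) := by
    refine Real.log_nonneg ?_
    rw [le_div_iff₀ I.minProb_pos]
    linarith [I.minProb_le_one]
  -- If the root stops, greedy pays nothing; this covers the degenerate cases where a cap equals 1.
  -- Otherwise `n ≥ 2` and `p_min ≤ 1 / 2`, so additive constants are absorbed by the logarithms.
  by_cases hU : I.Stops Finset.univ
  · have h0 : I.expectedCost T = 0 := by
      cases hT with
      | leaf N S c hdone hmaj => simp [expectedCost, pathCost]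
      | node N S t child hgo ht hchild => exact absurd hU hgo
    rw [h0]
    have := Real.log_natCast_nonneg n
    positivity
  have hcap : ∀ i, I.cap i < 1 := fun i => I.cap_lt_one hU (Finset.mem_univ i)
  have hn2 : 2 ≤ n := by
    by_contra hlt
    have : Subsingleton (Fin n) := Fin.subsingleton_iff_le_one.2 (by omega)
    exact hU (.inl fun i _ j _ => congrArg _ (Subsingleton.elim i j))
  have hn2' : (2 : ℝ) ≤ n := by exact_mod_cast hn2
  have hp : I.minProb ≤ 1 / 2 := by
    have h1 := I.card_mul_minProb_le_one
    have h2 := mul_le_mul_of_nonneg_right hn2' I.minProb_pos.le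
    linarith
  have hB := I.scoreBound_of_eq hφ hp
  have hl2 := Real.log_two_gt_d9
  have hln : Real.log 2 ≤ Real.log n := Real.log_le_log two_pos hn2'
  set G := Real.log n / Real.log 2 + (2 + 2 * Real.log n + Real.log (1 / I.minProb)) +
    lam * (2 * Real.log (1 / I.minProb))
  have hdiv : Real.log n / Real.log 2 ≤ 2 * Real.log n := by
    rw [div_le_iff₀ (by linarith)]
    nlinarith
  have hdiv0 : 0 ≤ Real.log n / Real.log 2 := div_nonneg (by linarith) (by linarith)
  have hl := mul_nonneg hlam hlog0
  have hl' := mul_nonneg hlam (by linarith : 0 ≤ Real.log n)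
  have hG0 : 0 < G := by
    simp only [G]
    linarith
  have hGle : 4 * G ≤ 40 * (1 + lam) * (Real.log (1 / I.minProb) + Real.log n) := by
    simp only [G]
    linarith
  exact (GreedyRun.expectedCost_le I hB hlam hcap hT hT' hG0
    fun N hN => I.potential_le hB hcap hlam hN).trans (mul_le_mul_of_nonneg_right hGle hOPT)

end Problem

end GroupId

theorem mainTheorem2 :
    (∃ C : ℝ, 0 < C ∧
      ∀ (n k m : ℕ) (I : GroupId.Problem n k m), (∃ T, I.Feasible T) →
        ∀ φ : ℝ → ℝ, (φ = GroupId.entropyScore ∨ φ = GroupId.giniScore) →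
          ∀ lam : ℝ, 0 ≤ lam →
            (∃ T, I.IsGreedyOutput φ lam T) ∧
            ∀ T, I.IsGreedyOutput φ lam T →
              I.Feasible T ∧
              ∀ T', I.Feasible T' →
                I.expectedCost T ≤
                  C * (1 + lam) * (Real.log (1 / I.minProb) + Real.log n) * I.expectedCost T') ∧
    (∀ (n k m : ℕ) (I : GroupId.Problem n k m),
      I.maxScore GroupId.entropyScore ≤ Real.log (1 / I.minProb) ∧
      I.maxScore GroupId.giniScore ≤ 1) := by
  refine ⟨⟨40, by norm_num, ?_⟩, ?_⟩
  · intro n k m I ⟨T₀, hT₀⟩ φ hφ lam hlam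
    refine ⟨I.exists_greedyRun (GroupId.Problem.Feasible.solvable I hT₀) lam _ _ I.reached_univ,
      fun T hT => ⟨GroupId.Problem.GreedyRun.feasibleOn I hT, fun T' hT' => ?_⟩⟩
    exact GroupId.Problem.IsGreedyOutput.expectedCost_le I hφ hlam hT hT'
  · intro n k m I
    exact ⟨I.maxScore_le (GroupId.scoreBound_entropyScore I.minProb_pos),
      I.maxScore_le (GroupId.scoreBound_giniScore I.minProb_pos.le)⟩
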